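/- Let $k$ be an algebraically closed field of characteristic zero. **Question (El Kahoui).** Let $\mathcal A$ be a commutative associative unital $k$-algebra of transcendence degree $n>0$ over $k$ which is a unique factorization domain, and let $D$ be a set of $n-1$ commuting locally nilpotent $k$-derivations of $\mathcal A$ that are linearly independent over $\mathcal A$. Put $\mathcal A^D=\{a\in\mathcal A\mid \partial(a)=0 \text{ for every } \partial\in D\}$. Does the equality $\mathcal A^D=k[c]$ for some $c\in\mathcal A$ imply the existence of elements $s_1,\dots,s_{n-1}\in\mathcal A$ and $c_1,\dots,c_{n-1}\in k[c]$ such that $\mathcal A$ is the polynomial $k$-algebra $k[c,s_1,\dots,s_{n-1}]$ and $D=\{c_i\partial_{s_i}\}_{i=1}^{n-1}$? **Example 1.** Let $\ell\ge 3$, $n=2\ell-1$, $f=x_{-1}x_1+x_{-2}x_2+\cdots+x_{-\ell}x_\ell$, and $\mathcal A=k[x_1,\dots,x_\ell,x_{-\ell},\dots,x_{-1}]/(f)$. For $j\in\{2,\dots,\ell,-\ell,\dots,-2\}$ let $D_j$ be the $k$-derivation of the polynomial ring with $D_j(x_{-1})=-x_{-j}$, $D_j(x_j)=x_1$, and $D_j(x_i)=0$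 for $i\ne j,-1$. Then $D_j(f)=0$; let $\partial_j$ be the derivation of $\mathcal A$ induced by $D_j$. **Example 2.** Let $\ell\ge 2$, $n=2\ell$, $h=x_0^2+x_{-1}x_1+\cdots+x_{-\ell}x_\ell$, and $\mathcal A=k[x_1,\dots,x_\ell,x_0,x_{-\ell},\dots,x_{-1}]/(h)$. For $j\in\{2,\dots,\ell,0,-\ell,\dots,-2\}$ let $D_j$ be the $k$-derivation of the polynomial ring with $D_j(x_{-1})=-x_{-j}$ if $j\neq 0$, $D_0(x_{-1})=-2x_0$, $D_j(x_j)=x_1$, and $D_j(x_i)=0$ for $i\ne j,-1$. Then $D_j(h)=0$; let $\partial_j$ be the derivation of $\mathcal A$ induced by $D_j$. **Claim.** In both examples $\mathcal A$ is a unique factorization domain of transcendence degree $n$ over $k$, it is not a polynomial ring over $k$ (in any set of variables), and $\mathcal A^\star=k^\star$. The derivations $\partial_j$ are pairwise distinct, and $D=\{\partial_j\}$ is a set of $n-1$ commuting locally nilpotent $k$-derivations of $\mathcal A$, linearly independent over $\mathcal A$. The equality $\mathcal A^D=k[c]$ holds for some $c\in\mathcal A$, and for no $c\in\mathcal A$ with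 $\mathcal A^D=k[c]$ do elements $s_i\in\mathcal A$, $c_i\in k[c]$ as in the Question exist; that is, the answer to the Question for $(\mathcal A,D)$ is negative. Consequently, for every $n\ge 4$ the answer to the Question in transcendence degree $n$ is negative. -/

import Mathlib

universe u v

noncomputable section

open MvPolynomial

namespace KahouiQuestion

section General

variable {k : Type u} [CommRing k] {A : Type v} [CommRing A] [Algebra k A]

/-- A derivation is locally nilpotent if every element is killed by some iterate of it. -/
def IsLocallyNilpotent (d : Derivation k A A) : Prop :=
  ∀ a : A, ∃ m : ℕ, (⇑d)^[m] a = 0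

/-- The invariant algebra `A^D` of a set `D` of derivations. -/
def invariants (D : Set (Derivation k A A)) : Subalgebra k A where
  carrier := {a | ∀ d ∈ D, d a = 0}
  mul_mem' := by
    intro a b ha hb d hd
    simp [Derivation.leibniz, ha d hd, hb d hd]
  add_mem' := by
    intro a b ha hb d hd
    simp [ha d hd, hb d hd]
  algebraMap_mem' := by
    intro r d _
    exact d.map_algebraMap r

variable (k A) in
/-- The standing assumptions of the question: `A` is a unique factorization domain of
transcendence degree `n > 0` over `k`, and `D` is a set of `n - 1` commuting locally nilpotent
`k`-derivations of `A` that are linearly independent over `A`. -/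
structure IsAdmissible (n : ℕ) (D : Set (Derivation k A A)) : Prop where
  pos : 0 < n
  isDomain : IsDomain A
  ufd : UniqueFactorizationMonoid A
  trdeg : Algebra.trdeg k A = (n : Cardinal)
  card : D.encard = ((n - 1 : ℕ) : ℕ∞)
  locallyNilpotent : ∀ d ∈ D, IsLocallyNilpotent d
  commute : ∀ d ∈ D, ∀ d' ∈ D, ∀ a : A, d (d' a) = d' (d a)
  linearIndependent : LinearIndependent A (fun d : D => (d : Derivation k A A))

/-- There are `s_1, …, s_{n-1}` in `A` and `c_1, …, c_{n-1}` in `k[c]` such that `A` is the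
polynomial algebra `k[c, s_1, …, s_{n-1}]` (its generators `c, s_1, …, s_{n-1}` being
algebraically independent) and `D = {c_i ∂_{s_i}}`. Here `δ i` is the partial derivative
with respect to `s_i`: the `k`-derivation of `A` with `c ↦ 0` and `s_j ↦ δ_{ij}`. -/
def HasPolynomialForm (n : ℕ) (D : Set (Derivation k A A)) (c : A) : Prop :=
  ∃ (s : Fin (n - 1) → A) (γ : Fin (n - 1) → A) (δ : Fin (n - 1) → Derivation k A A),
    AlgebraicIndependent k (fun o : Option (Fin (n - 1)) => o.elim c s) ∧
    Algebra.adjoin k (insert c (Set.range s)) = ⊤ ∧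
    (∀ i, γ i ∈ Algebra.adjoin k {c}) ∧
    (∀ i, δ i c = 0 ∧ ∀ j, δ i (s j) = if i = j then 1 else 0) ∧
    D = Set.range (fun i => γ i • δ i)

end General

/-- The affirmative answer to El Kahoui's question in dimension `n` over `k`. -/
def AffirmativeAnswer (k : Type u) [Field k] (n : ℕ) : Prop :=
  ∀ (A : Type u) [CommRing A] [Algebra k A] (D : Set (Derivation k A A)),
    IsAdmissible k A n D →
    ∀ c : A, invariants D = Algebra.adjoin k {c} → HasPolynomialForm n D c

/-- The derivation of `R / (f)` induced by a derivation `d` of `R` with `d f = 0`. -/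
def quotientDerivation {k : Type u} [CommRing k] {R : Type v} [CommRing R] [Algebra k R]
    (f : R) (d : Derivation k R R) (hd : d f = 0) :
    Derivation k (R ⧸ Ideal.span {f}) (R ⧸ Ideal.span {f}) :=
  Derivation.liftOfSurjective (f := Ideal.Quotient.mkₐ k (Ideal.span {f})) (d := d)
    (Ideal.Quotient.mkₐ_surjective k (Ideal.span {f})) (by
      intro x hx
      rw [Ideal.Quotient.mkₐ_eq_mk, Ideal.Quotient.eq_zero_iff_mem,
        Ideal.mem_span_singleton'] at hx ⊢
      obtain ⟨a, rfl⟩ := hx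
      exact ⟨d a, by simp [Derivation.leibniz, hd, mul_comm]⟩)

theorem quotientDerivation_mk {k : Type u} [CommRing k] {R : Type v} [CommRing R] [Algebra k R]
    (f : R) (d : Derivation k R R) (hd : d f = 0) (x : R) :
    quotientDerivation f d hd (Ideal.Quotient.mk (Ideal.span {f}) x) =
      Ideal.Quotient.mk (Ideal.span {f}) (d x) :=
  Derivation.liftOfSurjective_apply (f := Ideal.Quotient.mkₐ k (Ideal.span {f})) (d := d)
    (Ideal.Quotient.mkₐ_surjective k (Ideal.span {f})) (by
      intro x hx
      rw [Ideal.Quotient.mkₐ_eq_mk, Ideal.Quotient.eq_zero_iff_mem,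
        Ideal.mem_span_singleton'] at hx ⊢
      obtain ⟨a, rfl⟩ := hx
      exact ⟨d a, by simp [Derivation.leibniz, hd, mul_comm]⟩) x

/-! ### The quadratic cone `x_{-1} x_1 + ⋯ + x_{-ℓ} x_ℓ = 0` -/

/-- Indices `±1, …, ±ℓ`: for `i = 0, …, ℓ - 1`, `inl i` stands for `i + 1` and `inr i` for
`-(i + 1)`. -/
abbrev EvenIdx (ℓ : ℕ) : Type := Fin ℓ ⊕ Fin ℓ

/-- The index `-j`. -/
def EvenIdx.opp {ℓ : ℕ} (j : EvenIdx ℓ) : EvenIdx ℓ := Sum.swap j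

/-- The form `f = x_{-1} x_1 + ⋯ + x_{-ℓ} x_ℓ`. -/
def evenForm (k : Type u) [Field k] (ℓ : ℕ) : MvPolynomial (EvenIdx ℓ) k :=
  ∑ i : Fin ℓ, X (Sum.inr i) * X (Sum.inl i)

/-- The algebra `k[x_1, …, x_ℓ, x_{-ℓ}, …, x_{-1}] / (f)`. -/
abbrev EvenCone (k : Type u) [Field k] (ℓ : ℕ) : Type u :=
  MvPolynomial (EvenIdx ℓ) k ⧸ Ideal.span {evenForm k ℓ}

/-- The indices `2, …, ℓ, -ℓ, …, -2`. -/
abbrev EvenDerIdx (ℓ : ℕ) [NeZero ℓ] : Type :=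
  {j : EvenIdx ℓ // j ≠ Sum.inl 0 ∧ j ≠ Sum.inr 0}

/-- The derivation `D_j` of the polynomial ring: `x_{-1} ↦ -x_{-j}`, `x_j ↦ x_1`, and `x_i ↦ 0`
for `i ≠ j, -1`. -/
def evenPolyDer (k : Type u) [Field k] (ℓ : ℕ) [NeZero ℓ] (j : EvenDerIdx ℓ) :
    Derivation k (MvPolynomial (EvenIdx ℓ) k) (MvPolynomial (EvenIdx ℓ) k) :=
  mkDerivation k fun i =>
    if i = Sum.inr 0 then -X (EvenIdx.opp j.1)
    else if i = j.1 then X (Sum.inl 0)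
    else 0

theorem evenPolyDer_form (k : Type u) [Field k] (ℓ : ℕ) [NeZero ℓ] (j : EvenDerIdx ℓ) :
    evenPolyDer k ℓ j (evenForm k ℓ) = 0 := by
  obtain ⟨j, h1, h2⟩ := j
  simp only [evenForm, evenPolyDer, map_sum, Derivation.leibniz, mkDerivation_X, smul_eq_mul,
    Finset.sum_add_distrib]
  rcases j with a | a
  · have ha : a ≠ 0 := fun h => h1 (by rw [h])
    simp [EvenIdx.opp, mul_ite, Finset.sum_ite_eq', mul_comm]
  · have ha : a ≠ 0 := fun h => h2 (by rw [h])
    have key : ∀ i : Fin ℓ, (if i = 0 then -X (Sum.inl a) else if i = a then X (Sum.inl 0) else 0 :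
        MvPolynomial (EvenIdx ℓ) k) =
        (if i = 0 then -X (Sum.inl a) else 0) + (if i = a then X (Sum.inl 0) else 0) := by
      intro i
      split_ifs with h3 h4 <;> simp_all
    simp [EvenIdx.opp, key, mul_add, Finset.sum_add_distrib, mul_ite, mul_comm]

/-- The derivation `∂_j` induced by `D_j` on `k[x] / (f)`. -/
def evenDer (k : Type u) [Field k] (ℓ : ℕ) [NeZero ℓ] (j : EvenDerIdx ℓ) :
    Derivation k (EvenCone k ℓ) (EvenCone k ℓ) :=
  quotientDerivation (evenForm k ℓ) (evenPolyDer k ℓ j) (evenPolyDer_form k ℓ j)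

/-! ### The quadratic cone `x_0² + x_{-1} x_1 + ⋯ + x_{-ℓ} x_ℓ = 0` -/

/-- Indices `0, ±1, …, ±ℓ`: `none` stands for `0`, and for `i = 0, …, ℓ - 1`, `some (inl i)`
stands for `i + 1` and `some (inr i)` for `-(i + 1)`. -/
abbrev OddIdx (ℓ : ℕ) : Type := Option (Fin ℓ ⊕ Fin ℓ)

/-- The index `-j`. -/
def OddIdx.opp {ℓ : ℕ} (j : OddIdx ℓ) : OddIdx ℓ := Option.map Sum.swap j

/-- The form `h = x_0² + x_{-1} x_1 + ⋯ + x_{-ℓ} x_ℓ`. -/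
def oddForm (k : Type u) [Field k] (ℓ : ℕ) : MvPolynomial (OddIdx ℓ) k :=
  X none ^ 2 + ∑ i : Fin ℓ, X (some (Sum.inr i)) * X (some (Sum.inl i))

/-- The algebra `k[x_1, …, x_ℓ, x_0, x_{-ℓ}, …, x_{-1}] / (h)`. -/
abbrev OddCone (k : Type u) [Field k] (ℓ : ℕ) : Type u :=
  MvPolynomial (OddIdx ℓ) k ⧸ Ideal.span {oddForm k ℓ}

/-- The indices `2, …, ℓ, 0, -ℓ, …, -2`. -/
abbrev OddDerIdx (ℓ : ℕ) [NeZero ℓ] : Type :=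
  {j : OddIdx ℓ // j ≠ some (Sum.inl 0) ∧ j ≠ some (Sum.inr 0)}

/-- The derivation `D_j` of the polynomial ring: `x_{-1} ↦ -x_{-j}` if `j ≠ 0` and
`x_{-1} ↦ -2 x_0` if `j = 0`, `x_j ↦ x_1`, and `x_i ↦ 0` for `i ≠ j, -1`. -/
def oddPolyDer (k : Type u) [Field k] (ℓ : ℕ) [NeZero ℓ] (j : OddDerIdx ℓ) :
    Derivation k (MvPolynomial (OddIdx ℓ) k) (MvPolynomial (OddIdx ℓ) k) :=
  mkDerivation k fun i =>
    if i = some (Sum.inr 0) then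
      (if j.1 = none then -(2 * X none) else -X (OddIdx.opp j.1))
    else if i = j.1 then X (some (Sum.inl 0))
    else 0

theorem oddPolyDer_form (k : Type u) [Field k] (ℓ : ℕ) [NeZero ℓ] (j : OddDerIdx ℓ) :
    oddPolyDer k ℓ j (oddForm k ℓ) = 0 := by
  obtain ⟨j, h1, h2⟩ := j
  simp only [oddForm, oddPolyDer, map_add, map_sum, Derivation.leibniz, Derivation.leibniz_pow,
    mkDerivation_X, smul_eq_mul, Finset.sum_add_distrib]
  rcases j with _ | a | a
  · simp [mul_ite]
    ring
  · have ha : a ≠ 0 := fun h => h1 (by rw [h])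
    simp [OddIdx.opp, mul_ite, mul_comm]
  · have ha : a ≠ 0 := fun h => h2 (by rw [h])
    have key : ∀ i : Fin ℓ, (if i = 0 then -X (some (Sum.inl a)) else
        if i = a then X (some (Sum.inl 0)) else 0 : MvPolynomial (OddIdx ℓ) k) =
        (if i = 0 then -X (some (Sum.inl a)) else 0) +
          (if i = a then X (some (Sum.inl 0)) else 0) := by
      intro i
      split_ifs with h3 h4 <;> simp_all
    simp [OddIdx.opp, key, mul_add, Finset.sum_add_distrib, mul_ite, mul_comm]

/-- The derivation `∂_j` induced by `D_j` on `k[x] / (h)`. -/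
def oddDer (k : Type u) [Field k] (ℓ : ℕ) [NeZero ℓ] (j : OddDerIdx ℓ) :
    Derivation k (OddCone k ℓ) (OddCone k ℓ) :=
  quotientDerivation (oddForm k ℓ) (oddPolyDer k ℓ j) (oddPolyDer_form k ℓ j)

end KahouiQuestion

end

open KahouiQuestion

open KahouiQuestion

namespace KahouiQuestion

open MvPolynomial

/-! ### Specializations of polynomials that omit some variables. -/

section Supported

variable {k : Type*} [Field k] {ι : Type*} {B : Type*} [CommRing B] [Algebra k B]

/-! Both forms are F = x_p x_m + Q with Q a quadratic form free of x_p and x_m, and everything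
follows from this shape. Put A = k[x]/(F). Inverting x_p solves for x_m = -Q/x_p, so A embeds in the
field k(x) and agrees with k[x_i : i ≠ m] up to powers of x_p (`chart_eq_zero_iff`). Hence F is
prime and the transcendence degree is one less than the number of variables. Since A/(x_p) is a
polynomial ring modulo Q, the element x_p is prime in A once Q is (`prime_mk_X`); Q is prime because
it has the same shape on fewer variables. Nagata's criterion then makes A factorial.

The derivations are induced by x_p ∂_j - (∂_j Q) ∂_m. On k[x_i : i ≠ m] they act as x_p ∂_j, whence
independence and, in characteristic zero, A^D = k[x_p] (`invariants_eq`).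

A is not a polynomial ring because the origin is a singular point of the cone: F has no linear part,
so the cotangent space there has dimension n + 1 instead of n (`isEmpty_algEquiv`). This rules out
the polynomial form for every c. -/

theorem algHom_eq_of_mem_supported {s : Set ι} (f g : MvPolynomial ι k →ₐ[k] B)
    (h : ∀ i ∈ s, f (X i) = g (X i)) {a : MvPolynomial ι k} (ha : a ∈ supported k s) :
    f a = g a := by
  have : supported k s ≤ AlgHom.equalizer f g := by
    rw [supported_eq_adjoin_X, Algebra.adjoin_le_iff]
    rintro _ ⟨i, hi, rfl⟩
    exact h i hi
  exact this ha

open Classical in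
/-- The specialization `X p ↦ 0`. -/
noncomputable def killVar (k : Type*) [Field k] {ι : Type*} (p : ι) :
    MvPolynomial ι k →ₐ[k] MvPolynomial ι k :=
  aeval fun i => if i = p then 0 else X i

@[simp]
theorem killVar_X_self (p : ι) : killVar k p (X p) = 0 := by simp [killVar]

theorem killVar_of_mem_supported {p : ι} {s : Set ι} (hs : p ∉ s) {a : MvPolynomial ι k}
    (ha : a ∈ supported k s) : killVar k p a = a := by
  refine algHom_eq_of_mem_supported (killVar k p) (AlgHom.id k _) (fun i hi => ?_) ha
  have : i ≠ p := fun h => hs (h ▸ hi)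
  simp [killVar, this]

theorem X_dvd_sub_killVar (p : ι) (a : MvPolynomial ι k) : X p ∣ a - killVar k p a := by
  induction a using MvPolynomial.induction_on with
  | C r => simp [killVar, algHom_C]
  | add a b ha hb =>
    rw [map_add, add_sub_add_comm]
    exact dvd_add ha hb
  | mul_X a i ha =>
    rw [map_mul]
    by_cases h : i = p
    · subst h; simp
    · have : killVar k p (X i) = X i := by simp [killVar, h]
      rw [this, ← sub_mul]
      exact ha.mul_right _

theorem X_dvd_of_killVar_eq_zero {p : ι} {a : MvPolynomial ι k} (h : killVar k p a = 0) :
    X p ∣ a := by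
  simpa [h] using X_dvd_sub_killVar p a

end Supported

/-- `F = x_p x_m + Q`, where `Q` is a nonzero quadratic form not involving `x_p` and `x_m`. -/
structure IsHyperbolic {k : Type*} [Field k] {ι : Type*} (p m : ι) (F Q : MvPolynomial ι k) :
    Prop where
  ne : p ≠ m
  eq : F = X p * X m + Q
  mem : Q ∈ supported k {i | i ≠ p ∧ i ≠ m}
  ne_zero : Q ≠ 0
  homogeneous : Q.IsHomogeneous 2

/-! ### The hypersurface x_p x_m + Q = 0: birational chart and primality -/

namespace IsHyperbolic

variable {k : Type*} [Field k] {ι : Type*} {p m : ι} {F Q : MvPolynomial ι k}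

open Classical in
/-- The birational parametrization of the hypersurface `F = 0` by the coordinates other
than `x_m`. -/
noncomputable def chart (p m : ι) (Q : MvPolynomial ι k) :
    MvPolynomial ι k →ₐ[k] FractionRing (MvPolynomial ι k) :=
  aeval fun i => if i = m then -algebraMap (MvPolynomial ι k) _ Q /
    algebraMap (MvPolynomial ι k) _ (X p) else algebraMap (MvPolynomial ι k) _ (X i)

theorem chart_of_mem {g : MvPolynomial ι k} (hg : g ∈ supported k {i | i ≠ m}) :
    chart p m Q g = algebraMap _ (FractionRing (MvPolynomial ι k)) g := by
  refine algHom_eq_of_mem_supported (chart p m Q)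
    (IsScalarTower.toAlgHom k (MvPolynomial ι k) _) (fun i hi => ?_) hg
  have : i ≠ m := hi
  simp [chart, this]

theorem X_ne_zero' (p : ι) :
    algebraMap _ (FractionRing (MvPolynomial ι k)) (X p : MvPolynomial ι k) ≠ 0 := by
  rw [Ne, FaithfulSMul.algebraMap_eq_zero_iff]
  exact X_ne_zero p

theorem chart_form (h : IsHyperbolic p m F Q) : chart p m Q F = 0 := by
  have hQ : Q ∈ supported k {i | i ≠ m} := supported_mono (fun i hi => hi.2) h.mem
  have hp : (X p : MvPolynomial ι k) ∈ supported k {i | i ≠ m} := X_mem_supported.2 h.ne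
  have h0 := X_ne_zero' (k := k) p
  have hm : chart p m Q (X m) = -algebraMap (MvPolynomial ι k) _ Q /
      algebraMap (MvPolynomial ι k) _ (X p) := by simp [chart]
  rw [h.eq, map_add, map_mul, chart_of_mem hQ, chart_of_mem hp, hm]
  field_simp
  ring

theorem killVar_form (h : IsHyperbolic p m F Q) : killVar k p F = Q := by
  rw [h.eq, map_add, map_mul, killVar_X_self, zero_mul, zero_add]
  exact killVar_of_mem_supported (fun hh => hh.1 rfl) h.mem

theorem form_ne_zero (h : IsHyperbolic p m F Q) : F ≠ 0 := by
  intro h0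
  have := h.killVar_form
  rw [h0, map_zero] at this
  exact h.ne_zero this.symm

/-- If x_p a = F b, setting x_p = 0 leaves Q · b(x_p = 0) = 0, so x_p divides b and can be
cancelled. -/
theorem dvd_of_dvd_X_mul (h : IsHyperbolic p m F Q) {a : MvPolynomial ι k}
    (ha : F ∣ X p * a) : F ∣ a := by
  obtain ⟨b, hb⟩ := ha
  have h1 := congrArg (killVar k p) hb
  rw [map_mul, map_mul, killVar_X_self, zero_mul, h.killVar_form] at h1
  obtain ⟨c, rfl⟩ := X_dvd_of_killVar_eq_zero ((mul_eq_zero.1 h1.symm).resolve_left h.ne_zero)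
  refine ⟨c, mul_left_cancel₀ (X_ne_zero p) ?_⟩
  rw [hb]; ring

theorem dvd_of_dvd_X_pow_mul (h : IsHyperbolic p m F Q) {a : MvPolynomial ι k} {N : ℕ}
    (ha : F ∣ X p ^ N * a) : F ∣ a := by
  induction N with
  | zero => simpa using ha
  | succ N ih =>
    rw [pow_succ', mul_assoc] at ha
    exact ih (h.dvd_of_dvd_X_mul ha)

/-- Modulo F one has x_p x_m ≡ -Q, so each occurrence of x_m is eliminated at the cost of one factor
x_p. -/
theorem exists_dvd_X_pow_mul_sub (h : IsHyperbolic p m F Q) (a : MvPolynomial ι k) :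
    ∃ N : ℕ, ∃ g ∈ supported k {i | i ≠ m}, F ∣ X p ^ N * a - g := by
  have hQ : Q ∈ supported k {i | i ≠ m} := supported_mono (fun i hi => hi.2) h.mem
  have hp : (X p : MvPolynomial ι k) ∈ supported k {i | i ≠ m} := X_mem_supported.2 h.ne
  induction a using MvPolynomial.induction_on with
  | C r => exact ⟨0, C r, Subalgebra.algebraMap_mem _ r, by simp⟩
  | add a b ha hb =>
    obtain ⟨N, g, hg, u, hu⟩ := ha
    obtain ⟨M, g', hg', v, hv⟩ := hb
    refine ⟨N + M, X p ^ M * g + X p ^ N * g', add_mem (mul_mem (pow_mem hp _) hg)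
      (mul_mem (pow_mem hp _) hg'), X p ^ M * u + X p ^ N * v, ?_⟩
    linear_combination X p ^ M * hu + X p ^ N * hv
  | mul_X a i ha =>
    obtain ⟨N, g, hg, u, hu⟩ := ha
    by_cases hi : i = m
    · subst hi
      refine ⟨N + 1, -(g * Q), neg_mem (mul_mem hg hQ), X p * X i * u + g, ?_⟩
      rw [h.eq] at hu ⊢
      linear_combination X p * X i * hu
    · refine ⟨N, g * X i, mul_mem hg (X_mem_supported.2 hi), X i * u, ?_⟩
      linear_combination X i * hu

/-- Elimination of x_m reduces the kernel to polynomials free of x_m, where the chart is the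
inclusion into the fraction field; the power of x_p is then cancelled modulo F. -/
theorem chart_eq_zero_iff (h : IsHyperbolic p m F Q) {a : MvPolynomial ι k} :
    chart p m Q a = 0 ↔ F ∣ a := by
  constructor
  · intro ha
    obtain ⟨N, g, hg, u, hu⟩ := h.exists_dvd_X_pow_mul_sub a
    have h1 := congrArg (chart p m Q) hu
    rw [map_sub, map_mul, map_mul, ha, h.chart_form, mul_zero, zero_mul, zero_sub, neg_eq_zero,
      chart_of_mem hg, FaithfulSMul.algebraMap_eq_zero_iff] at h1
    rw [h1, sub_zero] at hu
    exact h.dvd_of_dvd_X_pow_mul ⟨u, hu⟩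
  · rintro ⟨b, rfl⟩
    rw [map_mul, h.chart_form, zero_mul]

theorem prime (h : IsHyperbolic p m F Q) : Prime F := by
  refine ⟨h.form_ne_zero, fun hu => ?_, fun a b hab => ?_⟩
  · have := (h.chart_eq_zero_iff (a := 1)).2 hu.dvd
    simp at this
  · rw [← h.chart_eq_zero_iff, map_mul, mul_eq_zero] at hab
    simpa only [h.chart_eq_zero_iff] using hab

theorem isDomain (h : IsHyperbolic p m F Q) : IsDomain (MvPolynomial ι k ⧸ Ideal.span {F}) :=
  have := (Ideal.span_singleton_prime h.form_ne_zero).2 h.prime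
  Ideal.Quotient.isDomain _

theorem mk_eq_zero_iff {F a : MvPolynomial ι k} :
    Ideal.Quotient.mk (Ideal.span {F}) a = 0 ↔ F ∣ a := by
  rw [Ideal.Quotient.eq_zero_iff_mem, Ideal.mem_span_singleton]

theorem prime_mk_X (h : IsHyperbolic p m F Q) (hQ : Prime Q) :
    Prime (Ideal.Quotient.mk (Ideal.span {F}) (X p)) := by
  -- Killing x_p turns F into Q: this is the identification of A/(x_p) with polynomials in the other
  -- variables modulo Q.
  have key : ∀ a : MvPolynomial ι k, Ideal.Quotient.mk (Ideal.span {F}) (X p) ∣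
      Ideal.Quotient.mk (Ideal.span {F}) a ↔ Q ∣ killVar k p a := by
    intro a
    constructor
    · rintro ⟨b, hb⟩
      obtain ⟨b, rfl⟩ := Ideal.Quotient.mk_surjective b
      rw [← map_mul, ← sub_eq_zero, ← map_sub, mk_eq_zero_iff] at hb
      obtain ⟨c, hc⟩ := hb
      refine ⟨killVar k p c, ?_⟩
      have := congrArg (killVar k p) hc
      simpa [h.killVar_form] using this
    · rintro ⟨c, hc⟩
      obtain ⟨d, hd⟩ := X_dvd_sub_killVar p a
      -- From a = x_p d + Q c and Q = F - x_p x_m.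
      refine ⟨Ideal.Quotient.mk _ (d - X m * c), ?_⟩
      rw [← map_mul, ← sub_eq_zero, ← map_sub, mk_eq_zero_iff]
      refine ⟨c, ?_⟩
      rw [h.eq]
      linear_combination hd + hc
  refine ⟨fun h0 => ?_, fun hu => ?_, fun a b hab => ?_⟩
  · rw [mk_eq_zero_iff, ← h.chart_eq_zero_iff, chart_of_mem (X_mem_supported.2 h.ne)] at h0
    exact X_ne_zero' p h0
  · have := (key 1).1 (by rw [map_one]; exact hu.dvd)
    rw [map_one] at this
    exact hQ.not_isUnit (isUnit_of_dvd_one this)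
  · obtain ⟨a, rfl⟩ := Ideal.Quotient.mk_surjective a
    obtain ⟨b, rfl⟩ := Ideal.Quotient.mk_surjective b
    rw [← map_mul, key, map_mul] at hab
    simpa only [key] using hQ.dvd_or_dvd hab

end IsHyperbolic

/-- A form of Nagata's criterion: if a Noetherian domain `A` is contained in the localization
of a factorial subring at an element which is prime in `A`, then `A` is factorial. -/
theorem uniqueFactorizationMonoid_of_prime_of_subring {S A : Type*} [CommRing S] [IsDomain S]
    [UniqueFactorizationMonoid S] [CommRing A] [IsDomain A] [IsNoetherianRing A] (f : S →+* A)
    (hf : Function.Injective f) (x : S) (hx : Prime (f x))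
    (H : ∀ a : A, ∃ N : ℕ, ∃ s : S, f x ^ N * a = f s) : UniqueFactorizationMonoid A := by
  -- Kaplansky's criterion: every nonzero prime ideal must contain a prime element.
  refine UniqueFactorizationMonoid.iff_exists_prime_mem_of_isPrime.2 fun P hP hPp => ?_
  by_cases hxP : f x ∈ P
  · exact ⟨_, hxP, hx⟩
  obtain ⟨a, haP, ha0⟩ := Submodule.exists_mem_ne_zero_of_ne_bot hP
  obtain ⟨N, s, hs⟩ := H a
  have hsP : s ∈ P.comap f := by
    rw [Ideal.mem_comap, ← hs]
    exact P.mul_mem_left _ haP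
  have hs0 : s ≠ 0 := by
    rintro rfl
    rw [map_zero, mul_eq_zero] at hs
    exact hs.elim (pow_ne_zero _ hx.ne_zero) ha0
  have hbot : P.comap f ≠ ⊥ := fun h => hs0 (by simpa [h] using hsP)
  obtain ⟨q, hqP, hq⟩ := (Ideal.IsPrime.comap f (K := P)).exists_mem_prime_of_ne_bot hbot
  rw [Ideal.mem_comap] at hqP
  have hqx : ∀ M : ℕ, ¬ q ∣ x ^ M := fun M hd => by
    obtain ⟨c, hc⟩ := hq.dvd_of_dvd_pow hd
    exact hxP (by rw [hc, map_mul]; exact P.mul_mem_right _ hqP)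
  have hq0 : f q ≠ 0 := fun h0 => hq.ne_zero (hf (by rw [h0, map_zero]))
  -- The image of q may acquire factors `f x` in A; removing them all (finitely many, A being
  -- Noetherian) gives the candidate prime q'.
  obtain ⟨q', hq', hq'x⟩ := (FiniteMultiplicity.of_not_isUnit hx.not_isUnit hq0
    ).exists_eq_pow_mul_and_not_dvd
  generalize multiplicity (f x) (f q) = M at hq'
  have hq'P : q' ∈ P := by
    rw [hq'] at hqP
    exact (hPp.mem_or_mem hqP).resolve_left fun h => hxP (hPp.mem_of_pow_mem _ h)
  -- The prime `f x` does not divide q', so in q' c = `f x` ^ N · a the whole power divides c.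
  have cancel : ∀ (N : ℕ) (a : A), q' ∣ f x ^ N * a → q' ∣ a := by
    rintro N a ⟨c, hc⟩
    obtain ⟨d, rfl⟩ := hx.pow_dvd_of_dvd_mul_left N hq'x (Dvd.intro a hc)
    refine ⟨d, mul_left_cancel₀ (pow_ne_zero N hx.ne_zero) ?_⟩
    rw [hc]; ring
  have hdvd : q' ∣ f q := ⟨f x ^ M, by rw [hq', mul_comm]⟩
  refine ⟨q', hq'P, ?_, fun hu => hPp.ne_top (Ideal.eq_top_of_isUnit_mem _ hq'P hu), ?_⟩
  · rintro rfl
    exact hq0 (by rw [hq', mul_zero])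
  · rintro a b ⟨c, hc⟩
    obtain ⟨Na, sa, ha⟩ := H a
    obtain ⟨Nb, sb, hb⟩ := H b
    obtain ⟨Nc, sc, hc'⟩ := H c
    -- The relation a b = q' c, cleared of denominators, becomes a divisibility in S, where q is
    -- prime and divides no power of x.
    have : q ∣ x ^ (M + Nc) * (sa * sb) := by
      refine ⟨x ^ (Na + Nb) * sc, hf ?_⟩
      simp only [map_mul, map_pow, ← ha, ← hb, ← hc', hq']
      linear_combination f x ^ (M + Nc + Na + Nb) * hc
    rcases hq.dvd_or_dvd ((hq.dvd_or_dvd this).resolve_left (hqx _)) with h | h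
    · exact Or.inl (cancel Na a (ha ▸ hdvd.trans (map_dvd f h)))
    · exact Or.inr (cancel Nb b (hb ▸ hdvd.trans (map_dvd f h)))

/-! ### Partial derivatives, homogeneity and the gradient at the origin -/

section PolynomialLemmas

variable {k : Type*} [Field k] {ι : Type*}

theorem pderiv_comm (i j : ι) (a : MvPolynomial ι k) :
    pderiv i (pderiv j a) = pderiv j (pderiv i a) := by
  classical
  have : ⁅pderiv (R := k) i, pderiv (R := k) j⁆ = 0 := by
    refine MvPolynomial.derivation_ext fun l => ?_
    rw [Derivation.commutator_apply, pderiv_X, pderiv_X]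
    simp only [Pi.single_apply]
    split_ifs <;> simp
  rw [← sub_eq_zero, ← Derivation.commutator_apply, this, Derivation.zero_apply]

theorem pderiv_eq_zero_of_mem_supported {s : Set ι} {i : ι} (hi : i ∉ s) {a : MvPolynomial ι k}
    (ha : a ∈ supported k s) : pderiv i a = 0 :=
  pderiv_eq_zero_of_notMem_vars fun h => hi (mem_supported.1 ha h)

theorem pderiv_mem_supported {s : Set ι} (i : ι) {a : MvPolynomial ι k}
    (ha : a ∈ supported k s) : pderiv i a ∈ supported k s := by
  classical
  rw [supported_eq_adjoin_X] at ha ⊢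
  induction ha using Algebra.adjoin_induction with
  | mem x hx =>
    obtain ⟨j, -, rfl⟩ := hx
    rw [pderiv_X, Pi.single_apply]
    split_ifs
    exacts [one_mem _, zero_mem _]
  | algebraMap r => rw [Derivation.map_algebraMap]; exact zero_mem _
  | add x y _ _ hx hy => rw [map_add]; exact add_mem hx hy
  | mul x y hx' hy' hx hy => rw [pderiv_mul]; exact add_mem (mul_mem hx hy') (mul_mem hx' hy)

theorem mem_supported_of_pderiv_eq_zero [CharZero k] {s : Set ι} {a : MvPolynomial ι k}
    (h : ∀ i ∉ s, pderiv i a = 0) : a ∈ supported k s := by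
  classical
  rw [mem_supported]
  intro i hi
  by_contra his
  obtain ⟨d, hd, hid⟩ := (mem_vars_iff_mem_support i).1 hi
  -- The coefficient of ∂_i a at d - e_i is d_i times that of a at d, and d_i ≠ 0 in characteristic
  -- zero.
  have h1 := congrArg (coeff (d - Finsupp.single i 1)) (h i his)
  have hdi : d i ≠ 0 := Finsupp.mem_support_iff.1 hid
  have h2 : d - Finsupp.single i 1 + Finsupp.single i 1 = d :=
    tsub_add_cancel_of_le (Finsupp.single_le_iff.2 (Nat.one_le_iff_ne_zero.2 hdi))
  rw [coeff_pderiv, h2, coeff_zero, mul_eq_zero] at h1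
  rcases h1 with h1 | h1
  · exact mem_support_iff.1 hd h1
  · exact Nat.cast_add_one_ne_zero _ h1

theorem aeval_mul_of_isHomogeneous {B : Type*} [CommRing B] [Algebra k B] {n : ℕ}
    {Q : MvPolynomial ι k} (hQ : Q.IsHomogeneous n) (c : B) (f : ι → B) :
    aeval (fun i => c * f i) Q = c ^ n * aeval f Q := by
  rw [aeval_def, aeval_def, eval₂_eq, eval₂_eq, Finset.mul_sum]
  refine Finset.sum_congr rfl fun d hd => ?_
  have hdeg : ∑ i ∈ d.support, d i = n := by
    have := hQ (mem_support_iff.1 hd)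
    rwa [Pi.one_def, ← Finsupp.degree_eq_weight_one, Finsupp.degree_apply] at this
  simp only [mul_pow]
  rw [Finset.prod_mul_distrib, Finset.prod_pow_eq_pow_sum, hdeg]
  ring

theorem aeval_zero_of_isHomogeneous {n : ℕ} (hn : n ≠ 0) {Q : MvPolynomial ι k}
    (hQ : Q.IsHomogeneous n) : aeval (fun _ => (0 : k)) Q = 0 := by
  have := aeval_mul_of_isHomogeneous hQ (0 : k) (fun _ => 0)
  simpa [hn] using this

variable (k ι) in
/-- The gradient at the origin. -/
noncomputable def gradient : MvPolynomial ι k →ₗ[k] (ι → k) :=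
  LinearMap.pi fun i => (aeval (fun _ => (0 : k))).toLinearMap ∘ₗ (pderiv i).toLinearMap

theorem gradient_apply (a : MvPolynomial ι k) (i : ι) :
    gradient k ι a i = aeval (fun _ => (0 : k)) (pderiv i a) := rfl

theorem gradient_mul (a b : MvPolynomial ι k) : gradient k ι (a * b) =
    aeval (fun _ => (0 : k)) a • gradient k ι b + aeval (fun _ => (0 : k)) b • gradient k ι a := by
  ext i
  simp only [gradient_apply, pderiv_mul, map_add, map_mul, Pi.add_apply, Pi.smul_apply,
    smul_eq_mul]
  ring

/-- A cotangent space bound: the gradient descends along π to a point derivation of the polynomial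
ring in σ, so its values are spanned by those at the card σ generators. Yet it takes the variables
of ι to a basis of k^ι. -/
theorem card_le_of_surjective [Fintype ι] {σ : Type*} [Fintype σ]
    (π : MvPolynomial ι k →ₐ[k] MvPolynomial σ k) (hπ : Function.Surjective π)
    (H : ∀ a, π a = 0 → gradient k ι a = 0) : Fintype.card ι ≤ Fintype.card σ := by
  classical
  choose w hw using fun s => hπ (X s)
  have H' : ∀ a b, π a = π b → gradient k ι a = gradient k ι b := fun a b hab => by
    rw [← sub_eq_zero, ← map_sub]
    exact H _ (by rw [map_sub, hab, sub_self])
  set W := Submodule.span k (Set.range fun s => gradient k ι (w s))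
  have key : ∀ b a, π a = b → gradient k ι a ∈ W := by
    intro b
    induction b using MvPolynomial.induction_on with
    | C r =>
      intro a ha
      have : gradient k ι a = 0 := by
        rw [H' a (C r) (by rw [ha, algHom_C]; rfl)]
        ext i
        simp [gradient_apply]
      rw [this]
      exact zero_mem _
    | add b c hb hc =>
      intro a ha
      obtain ⟨b', rfl⟩ := hπ b
      obtain ⟨c', rfl⟩ := hπ c
      rw [H' a (b' + c') (by rw [ha, map_add]), map_add]
      exact add_mem (hb _ rfl) (hc _ rfl)
    | mul_X b s hb =>
      intro a ha
      obtain ⟨b', rfl⟩ := hπ b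
      rw [H' a (b' * w s) (by rw [ha, map_mul, hw]), gradient_mul]
      exact add_mem (W.smul_mem _ (Submodule.subset_span ⟨s, rfl⟩)) (W.smul_mem _ (hb _ rfl))
  have htop : W = ⊤ := by
    rw [eq_top_iff, ← (Pi.basisFun k ι).span_eq, Submodule.span_le]
    rintro _ ⟨i, rfl⟩
    have : Pi.basisFun k ι i = gradient k ι (X i) := by
      ext j
      rw [gradient_apply, pderiv_X, Pi.basisFun_apply, Pi.single_apply, Pi.single_apply]
      by_cases h : j = i
      · simp [h]
      · simp [h, Ne.symm h]
    rw [this]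
    exact key _ _ rfl
  have h1 := finrank_range_le_card (R := k) (fun s => gradient k ι (w s))
  rw [Set.finrank] at h1
  change Module.finrank k W ≤ _ at h1
  rwa [htop, finrank_top, Module.finrank_fintype_fun_eq_card] at h1

end PolynomialLemmas

/-! ### Local nilpotency, and polynomial rings in one prime element -/

section Derivations

variable {k : Type*} [CommRing k] {A : Type*} [CommRing A] [Algebra k A]

/-- The elements killed by some iterate of a derivation form a subalgebra. -/
def nilpotentSubalgebra (d : Derivation k A A) : Subalgebra k A where
  carrier := {a | ∃ m : ℕ, (⇑d)^[m] a = 0}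
  mul_mem' := by
    -- Each Leibniz term of d (a b) lowers one of the two nilpotency orders by one, so induction on
    -- the bound N applies.
    have key : ∀ N m n : ℕ, m + n ≤ N → ∀ a b : A, (⇑d)^[m] a = 0 → (⇑d)^[n] b = 0 →
        (⇑d)^[N] (a * b) = 0 := by
      intro N
      induction N with
      | zero =>
        intro m n h a b ha _
        obtain ⟨rfl, -⟩ : m = 0 ∧ n = 0 := by omega
        have : a = 0 := ha
        simp [this]
      | succ N ih =>
        intro m n h a b ha hb
        rcases m with _ | m
        · have : a = 0 := ha
          simp [this]
        rcases n with _ | n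
        · have : b = 0 := hb
          simp [this]
        rw [Function.iterate_succ_apply, Derivation.leibniz, iterate_map_add, smul_eq_mul,
          smul_eq_mul, ih (m + 1) n (by omega) a (d b) ha
            (by rwa [Function.iterate_succ_apply] at hb),
          ih (n + 1) m (by omega) b (d a) hb
            (by rwa [Function.iterate_succ_apply] at ha), add_zero]
    rintro a b ⟨m, ha⟩ ⟨n, hb⟩
    exact ⟨m + n, key _ m n le_rfl a b ha hb⟩
  add_mem' := by
    rintro a b ⟨m, ha⟩ ⟨n, hb⟩
    refine ⟨m + n, ?_⟩
    rw [iterate_map_add, Function.iterate_add_apply _ m n b, hb, add_comm m n,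
      Function.iterate_add_apply _ n m a, ha, iterate_map_zero, iterate_map_zero, add_zero]
  algebraMap_mem' r := ⟨1, d.map_algebraMap r⟩

theorem mem_nilpotentSubalgebra_of_apply {d : Derivation k A A} {a : A}
    (h : d a ∈ nilpotentSubalgebra d) : a ∈ nilpotentSubalgebra d := by
  obtain ⟨m, hm⟩ := h
  exact ⟨m + 1, by rwa [Function.iterate_succ_apply]⟩

theorem HasPolynomialForm.nonempty_algEquiv {n : ℕ} {D : Set (Derivation k A A)} {c : A}
    (h : HasPolynomialForm n D c) : Nonempty (A ≃ₐ[k] MvPolynomial (Option (Fin (n - 1))) k) := by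
  obtain ⟨s, _, _, hs, htop, -⟩ := h
  refine ⟨(AlgEquiv.ofBijective (aeval fun o : Option (Fin (n - 1)) => o.elim c s)
    ⟨hs, ?_⟩).symm⟩
  rw [← AlgHom.range_eq_top, ← Algebra.adjoin_range_eq_range_aeval, ← htop]
  congr 1
  ext a
  simp [Option.exists, eq_comm]

/-- If `x` is prime, then `x ^ N * a ∈ k[x]` implies `a ∈ k[x]`. -/
theorem mem_adjoin_of_mul_mem_adjoin {k A : Type*} [Field k] [CommRing A] [IsDomain A]
    [Algebra k A] {x : A} (hx : Prime x) {N : ℕ} {a : A}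
    (ha : x ^ N * a ∈ Algebra.adjoin k {x}) : a ∈ Algebra.adjoin k {x} := by
  induction N with
  | zero => simpa using ha
  | succ N ih =>
    apply ih
    rw [Algebra.adjoin_singleton_eq_range_aeval] at ha ⊢
    obtain ⟨g, hg⟩ := ha
    change Polynomial.aeval x g = _ at hg
    rw [← Polynomial.divX_mul_X_add g, map_add, map_mul, Polynomial.aeval_X,
      Polynomial.aeval_C] at hg
    -- Otherwise x would divide a nonzero constant, hence be a unit.
    have h0 : g.coeff 0 = 0 := by
      by_contra h0
      refine hx.not_isUnit (isUnit_of_dvd_unit ?_ ((IsUnit.mk0 _ h0).map (algebraMap k A)))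
      exact ⟨x ^ N * a - Polynomial.aeval x g.divX, by rw [mul_sub]; linear_combination hg⟩
    rw [h0, map_zero, add_zero] at hg
    refine ⟨g.divX, mul_left_cancel₀ hx.ne_zero ?_⟩
    change x * Polynomial.aeval x g.divX = _
    linear_combination hg

end Derivations

open Cardinal

/-! ### Ring structure of the cone: factoriality, transcendence degree, units, singular origin -/

namespace IsHyperbolic

section Ring

variable {k : Type*} [Field k] {ι : Type*} {p m : ι} {F Q : MvPolynomial ι k}

theorem eq_zero_of_mk_eq_zero (h : IsHyperbolic p m F Q) {g : MvPolynomial ι k}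
    (hg : g ∈ supported k {i | i ≠ m}) (h0 : Ideal.Quotient.mk (Ideal.span {F}) g = 0) :
    g = 0 := by
  rwa [mk_eq_zero_iff, ← h.chart_eq_zero_iff, chart_of_mem hg,
    FaithfulSMul.algebraMap_eq_zero_iff] at h0

theorem exists_X_pow_mul_eq (h : IsHyperbolic p m F Q)
    (a : MvPolynomial ι k ⧸ Ideal.span {F}) : ∃ N : ℕ, ∃ g ∈ supported k {i | i ≠ m},
      Ideal.Quotient.mk (Ideal.span {F}) (X p) ^ N * a = Ideal.Quotient.mk _ g := by
  obtain ⟨a, rfl⟩ := Ideal.Quotient.mk_surjective a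
  obtain ⟨N, g, hg, hd⟩ := h.exists_dvd_X_pow_mul_sub a
  refine ⟨N, g, hg, ?_⟩
  rwa [← map_pow, ← map_mul, ← sub_eq_zero, ← map_sub, mk_eq_zero_iff]

/-- Nagata's criterion for the subring k[x_i : i ≠ m] and the prime x_p. -/
theorem uniqueFactorizationMonoid [Finite ι] (h : IsHyperbolic p m F Q) (hQ : Prime Q) :
    have := h.isDomain
    UniqueFactorizationMonoid (MvPolynomial ι k ⧸ Ideal.span {F}) := by
  have := h.isDomain
  have hmem : ∀ s : MvPolynomial {i | i ≠ m} k,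
      rename Subtype.val s ∈ supported k {i | i ≠ m} := fun s => by
    rw [supported_eq_range_rename]; exact ⟨s, rfl⟩
  refine uniqueFactorizationMonoid_of_prime_of_subring (S := MvPolynomial {i | i ≠ m} k)
    ((Ideal.Quotient.mk (Ideal.span {F})).comp
      (rename Subtype.val : MvPolynomial {i | i ≠ m} k →ₐ[k] MvPolynomial ι k).toRingHom)
    ?_ (X ⟨p, h.ne⟩) ?_ fun a => ?_
  · rw [injective_iff_map_eq_zero]
    intro s hs
    exact rename_injective _ Subtype.val_injective
      ((h.eq_zero_of_mk_eq_zero (hmem s) hs).trans (map_zero _).symm)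
  · simpa using h.prime_mk_X hQ
  · obtain ⟨N, g, hg, hN⟩ := h.exists_X_pow_mul_eq a
    rw [supported_eq_range_rename] at hg
    obtain ⟨s, rfl⟩ := hg
    exact ⟨N, s, by simpa using hN⟩

theorem isTranscendenceBasis (h : IsHyperbolic p m F Q) :
    IsTranscendenceBasis k fun i : {i | i ≠ m} =>
      Ideal.Quotient.mk (Ideal.span {F}) (X i.1) := by
  have := h.isDomain
  have haeval : ∀ s : MvPolynomial {i | i ≠ m} k,
      aeval (fun i : {i | i ≠ m} => Ideal.Quotient.mk (Ideal.span {F}) (X i.1)) s =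
        Ideal.Quotient.mk (Ideal.span {F}) (rename Subtype.val s) := by
    intro s
    have : aeval (fun i : {i | i ≠ m} => Ideal.Quotient.mk (Ideal.span {F}) (X i.1)) =
        (Ideal.Quotient.mkₐ k (Ideal.span {F})).comp (rename Subtype.val) :=
      MvPolynomial.algHom_ext fun i => by simp
    rw [this]; rfl
  have hmem : ∀ s : MvPolynomial {i | i ≠ m} k,
      rename Subtype.val s ∈ supported k {i | i ≠ m} := fun s => by
    rw [supported_eq_range_rename]; exact ⟨s, rfl⟩
  have hind : AlgebraicIndependent k fun i : {i | i ≠ m} =>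
      Ideal.Quotient.mk (Ideal.span {F}) (X i.1) := by
    rw [algebraicIndependent_iff]
    intro s hs
    rw [haeval] at hs
    exact rename_injective _ Subtype.val_injective
      ((h.eq_zero_of_mk_eq_zero (hmem s) hs).trans (map_zero _).symm)
  rw [hind.isTranscendenceBasis_iff_isAlgebraic]
  refine ⟨fun a => ?_⟩
  obtain ⟨N, g, hg, hN⟩ := h.exists_X_pow_mul_eq a
  rw [supported_eq_range_rename] at hg
  obtain ⟨s, rfl⟩ := hg
  set R := Algebra.adjoin k (Set.range fun i : {i | i ≠ m} =>
    Ideal.Quotient.mk (Ideal.span {F}) (X i.1))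
  have hs : Ideal.Quotient.mk (Ideal.span {F}) (rename Subtype.val s) ∈ R := by
    have hR : R = AlgHom.range (aeval _) := Algebra.adjoin_range_eq_range_aeval k _
    rw [← haeval, hR]
    exact ⟨s, rfl⟩
  have hx : Ideal.Quotient.mk (Ideal.span {F}) (X p) ∈ R :=
    Algebra.subset_adjoin ⟨⟨p, h.ne⟩, rfl⟩
  have hx0 : (⟨_, hx⟩ : R) ≠ 0 := fun h0 =>
    X_ne_zero p (h.eq_zero_of_mk_eq_zero (X_mem_supported.2 h.ne) (congrArg Subtype.val h0))
  -- Every a is a root of the linear polynomial x_p^N T - g over the subalgebra generated by the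
  -- family.
  refine ⟨Polynomial.C ((⟨_, hx⟩ : R) ^ N) * Polynomial.X - Polynomial.C ⟨_, hs⟩, ?_, ?_⟩
  · intro h0
    have := congrArg (fun q => Polynomial.coeff q 1) h0
    simp only [Polynomial.coeff_sub, Polynomial.coeff_C_mul, Polynomial.coeff_X_one,
      Polynomial.coeff_C_succ, Polynomial.coeff_zero, mul_one, sub_zero] at this
    exact pow_ne_zero N hx0 this
  · simp only [map_sub, map_mul, Polynomial.aeval_C, Polynomial.aeval_X, map_pow,
      Subalgebra.algebraMap_def]
    exact sub_eq_zero.2 hN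

theorem trdeg {ι : Type} [Fintype ι] {p m : ι} {F Q : MvPolynomial ι k}
    (h : IsHyperbolic p m F Q) : Algebra.trdeg k (MvPolynomial ι k ⧸ Ideal.span {F}) =
      ((Fintype.card ι - 1 : ℕ) : Cardinal) := by
  classical
  have := h.isDomain
  have h1 := h.isTranscendenceBasis.lift_cardinalMk_eq_trdeg
  have h2 : #{i | i ≠ m} = ((Fintype.card ι - 1 : ℕ) : Cardinal) := by
    rw [Cardinal.mk_fintype]
    congr 1
    simp [Fintype.card_subtype, Finset.filter_ne']
  rw [h2] at h1
  simpa using h1.symm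

open Classical in
/-- The parametrization of the cone `F = 0` by `x_p` and the ratios `x_i / x_p`. -/
noncomputable def blowup (p m : ι) (Q : MvPolynomial ι k) :
    MvPolynomial ι k →ₐ[k] MvPolynomial ι k :=
  aeval fun i => if i = p then X p else if i = m then -(X p * Q) else X p * X i

theorem blowup_form (h : IsHyperbolic p m F Q) : blowup p m Q F = 0 := by
  have hQ : blowup p m Q Q = X p ^ 2 * Q := by
    have h1 := aeval_mul_of_isHomogeneous h.homogeneous (X p) (X : ι → MvPolynomial ι k)
    rw [aeval_X_left_apply] at h1
    rw [← h1]
    refine algHom_eq_of_mem_supported (blowup p m Q) _ (fun i hi => ?_) h.mem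
    simp [blowup, hi.1, hi.2]
  have hp : blowup p m Q (X p) = X p := by simp [blowup]
  have hm : blowup p m Q (X m) = -(X p * Q) := by simp [blowup, h.ne.symm]
  rw [h.eq, map_add, map_mul, hp, hm, hQ]
  ring

theorem neg_mul_inv_sq_mul {K : Type*} [Field K] {y : K} (hy : y ≠ 0) (q : K) :
    -(y * (y⁻¹ ^ 2 * q)) = -q / y := by
  field_simp

/-- Rescaling x_i to x_i / x_p for i ≠ p undoes the blowup and recovers the chart, whose kernel is
known. -/
theorem blowup_eq_zero_iff (h : IsHyperbolic p m F Q) {a : MvPolynomial ι k} :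
    blowup p m Q a = 0 ↔ F ∣ a := by
  classical
  refine ⟨fun ha => ?_, ?_⟩
  · set L := FractionRing (MvPolynomial ι k)
    let t : ι → L := fun i => algebraMap (MvPolynomial ι k) L (X i)
    have ht : t p ≠ 0 := X_ne_zero' p
    let θ : MvPolynomial ι k →ₐ[k] L := aeval fun i => if i = p then t p else (t p)⁻¹ * t i
    have hθp : θ (X p) = t p := by simp [θ]
    have hθ : ∀ i, i ≠ p → θ (X i) = (t p)⁻¹ * t i := fun i hi => by simp [θ, hi]
    have hQ : θ Q = (t p)⁻¹ ^ 2 * algebraMap _ L Q := by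
      have h1 := aeval_mul_of_isHomogeneous h.homogeneous (t p)⁻¹ t
      have h2 : aeval t Q = algebraMap _ L Q := by
        have : aeval t = IsScalarTower.toAlgHom k (MvPolynomial ι k) L :=
          MvPolynomial.algHom_ext fun i => by simp [t]
        rw [this]; rfl
      rw [← h2, ← h1]
      refine algHom_eq_of_mem_supported θ _ (fun i hi => ?_) h.mem
      rw [hθ i hi.1, aeval_X]
    have hcomp : θ.comp (blowup p m Q) = chart p m Q := by
      refine MvPolynomial.algHom_ext fun i => ?_
      rw [AlgHom.comp_apply]
      by_cases hip : i = p
      · subst hip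
        simp [blowup, chart, h.ne, hθp, t, L]
      by_cases him : i = m
      · subst him
        have h1 : blowup p i Q (X i) = -(X p * Q) := by simp [blowup, hip]
        have h2 : chart p i Q (X i) = -algebraMap (MvPolynomial ι k) _ Q / t p := by
          simp [chart, t, L]
        rw [h1, h2, map_neg, map_mul, hθp, hQ]
        exact neg_mul_inv_sq_mul ht _
      · have h1 : blowup p m Q (X i) = X p * X i := by simp [blowup, hip, him]
        have h2 : chart p m Q (X i) = t i := by simp [chart, him, t, L]
        rw [h1, h2, map_mul, hθp, hθ i hip]
        exact mul_inv_cancel_left₀ ht _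
    rw [← h.chart_eq_zero_iff, ← hcomp, AlgHom.comp_apply, ha, map_zero]
  · rintro ⟨b, rfl⟩
    rw [map_mul, h.blowup_form, zero_mul]

/-- The blowup embeds the quotient in a polynomial ring, whose units are constants; the chart, with
values in a field, would not detect this. -/
theorem isUnit_iff (h : IsHyperbolic p m F Q) (a : MvPolynomial ι k ⧸ Ideal.span {F}) :
    IsUnit a ↔ ∃ r : k, r ≠ 0 ∧ algebraMap k (MvPolynomial ι k ⧸ Ideal.span {F}) r = a := by
  constructor
  · intro ha
    obtain ⟨b, hab⟩ := ha.exists_right_inv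
    obtain ⟨a, rfl⟩ := Ideal.Quotient.mk_surjective a
    obtain ⟨b, rfl⟩ := Ideal.Quotient.mk_surjective b
    rw [← map_mul, ← map_one (Ideal.Quotient.mk (Ideal.span {F})), ← sub_eq_zero, ← map_sub,
      mk_eq_zero_iff, ← h.blowup_eq_zero_iff, map_sub, map_mul, map_one, sub_eq_zero] at hab
    obtain ⟨r, hr, hra⟩ := isUnit_iff_eq_C_of_isReduced.1 (IsUnit.of_mul_eq_one _ hab)
    refine ⟨r, hr.ne_zero, ?_⟩
    change Ideal.Quotient.mk (Ideal.span {F}) (C r) = _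
    rw [← sub_eq_zero, ← map_sub, mk_eq_zero_iff, ← h.blowup_eq_zero_iff, map_sub, hra,
      algHom_C, algebraMap_eq, sub_self]
  · rintro ⟨r, hr, rfl⟩
    exact (IsUnit.mk0 r hr).map _

/-- The origin is singular: F and all its first partial derivatives vanish there. -/
theorem gradient_eq_zero_of_dvd (h : IsHyperbolic p m F Q) {a : MvPolynomial ι k} (ha : F ∣ a) :
    gradient k ι a = 0 := by
  obtain ⟨b, rfl⟩ := ha
  have hF : F.IsHomogeneous 2 := by
    rw [h.eq]
    exact ((isHomogeneous_X k p).mul (isHomogeneous_X k m)).add h.homogeneous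
  have hF' : gradient k ι F = 0 := by
    ext i
    exact aeval_zero_of_isHomogeneous one_ne_zero (hF.pderiv (i := i))
  rw [gradient_mul, hF', aeval_zero_of_isHomogeneous two_ne_zero hF, zero_smul, smul_zero,
    add_zero]

/-- Transcendence degree forces card σ = card ι - 1, while the cotangent space at the origin forces
card ι ≤ card σ. -/
theorem isEmpty_algEquiv {k : Type u} [Field k] {ι : Type} [Fintype ι] {p m : ι}
    {F Q : MvPolynomial ι k} (h : IsHyperbolic p m F Q) (σ : Type v) :
    IsEmpty ((MvPolynomial ι k ⧸ Ideal.span {F}) ≃ₐ[k] MvPolynomial σ k) := by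
  refine ⟨fun e => ?_⟩
  have h1 := e.lift_trdeg_eq
  rw [h.trdeg, MvPolynomial.trdeg_of_isDomain, Cardinal.lift_natCast, Cardinal.lift_lift,
    eq_comm, ← Cardinal.lift_natCast.{max u v} (Fintype.card ι - 1)] at h1
  have h2 : #σ = ((Fintype.card ι - 1 : ℕ) : Cardinal) := by simpa using h1
  have : Finite σ := by
    rw [← Cardinal.lt_aleph0_iff_finite, h2]
    exact Cardinal.natCast_lt_aleph0
  have := Fintype.ofFinite σ
  rw [Cardinal.mk_fintype, Nat.cast_inj] at h2
  have h3 := card_le_of_surjective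
    (e.toAlgHom.comp (Ideal.Quotient.mkₐ k (Ideal.span {F})))
    (e.surjective.comp (Ideal.Quotient.mkₐ_surjective k _)) fun a ha => by
      refine h.gradient_eq_zero_of_dvd (mk_eq_zero_iff.1 (e.injective ?_))
      rw [map_zero]
      exact ha
  have : 0 < Fintype.card ι := Fintype.card_pos_iff.2 ⟨p⟩
  omega

end Ring

/-! ### The commuting derivations of the cone and their invariants -/

section Derivations

variable {k : Type*} [Field k] {ι : Type*} {p m : ι} {F Q : MvPolynomial ι k}
  {d : {i : ι // i ≠ p ∧ i ≠ m} → Derivation k (MvPolynomial ι k ⧸ Ideal.span {F})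
    (MvPolynomial ι k ⧸ Ideal.span {F})}

/-- The derivations `d j` of `k[x] / (F)` are induced by `x_p ∂_j - (∂_j Q) ∂_m`. -/
def IsFamily (p m : ι) (F Q : MvPolynomial ι k)
    (d : {i : ι // i ≠ p ∧ i ≠ m} → Derivation k (MvPolynomial ι k ⧸ Ideal.span {F})
      (MvPolynomial ι k ⧸ Ideal.span {F})) : Prop :=
  ∀ j a, d j (Ideal.Quotient.mk _ a) =
    Ideal.Quotient.mk _ (X p * pderiv j.1 a - pderiv j.1 Q * pderiv m a)

/-- On polynomials free of x_m the ∂_m term drops out, leaving x_p ∂_j; the later computations rest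
on this. -/
theorem apply_of_mem (hd : IsFamily p m F Q d) (j : {i : ι // i ≠ p ∧ i ≠ m})
    {g : MvPolynomial ι k} (hg : g ∈ supported k {i | i ≠ m}) :
    d j (Ideal.Quotient.mk _ g) =
      Ideal.Quotient.mk _ (X p) * Ideal.Quotient.mk _ (pderiv j.1 g) := by
  rw [hd, pderiv_eq_zero_of_mem_supported (i := m) (by simp) hg, mul_zero, sub_zero,
    map_mul]

theorem apply_X_self (h : IsHyperbolic p m F Q) (hd : IsFamily p m F Q d)
    (j : {i : ι // i ≠ p ∧ i ≠ m}) : d j (Ideal.Quotient.mk _ (X p)) = 0 := by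
  rw [apply_of_mem hd j (X_mem_supported.2 h.ne), pderiv_X_of_ne j.2.1.symm, map_zero, mul_zero]

/-- Since x_p is invariant, multiplying an invariant by a power of x_p gives an invariant g free of
x_m. Then ∂_i g = 0 for all i ≠ p, so g lies in k[x_p], and primality of x_p allows dividing the
power back out. -/
theorem invariants_eq [CharZero k] (h : IsHyperbolic p m F Q) (hQ : Prime Q)
    (hd : IsFamily p m F Q d) : invariants (Set.range d) =
      Algebra.adjoin k {Ideal.Quotient.mk (Ideal.span {F}) (X p)} := by
  have := h.isDomain
  apply le_antisymm
  · intro a ha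
    obtain ⟨N, g, hg, hN⟩ := h.exists_X_pow_mul_eq a
    refine mem_adjoin_of_mul_mem_adjoin (h.prime_mk_X hQ) (N := N) ?_
    rw [hN]
    have hg' : g ∈ supported k {p} := by
      refine mem_supported_of_pderiv_eq_zero fun i hi => ?_
      by_cases him : i = m
      · subst him
        exact pderiv_eq_zero_of_mem_supported (by simp) hg
      have h1 : d ⟨i, hi, him⟩ (Ideal.Quotient.mk (Ideal.span {F}) g) = 0 := by
        rw [← hN, Derivation.leibniz, Derivation.leibniz_pow, h.apply_X_self hd, ha _ ⟨_, rfl⟩]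
        simp
      rw [apply_of_mem hd _ hg, mul_eq_zero] at h1
      exact h.eq_zero_of_mk_eq_zero (pderiv_mem_supported i hg)
        (h1.resolve_left (h.prime_mk_X hQ).ne_zero)
    rw [supported_eq_adjoin_X, Set.image_singleton] at hg'
    have h2 := Subalgebra.mem_map.2
      ⟨g, hg', (rfl : Ideal.Quotient.mkₐ k (Ideal.span {F}) g = _)⟩
    rwa [AlgHom.map_adjoin, Set.image_singleton] at h2
  · rw [Algebra.adjoin_le_iff, Set.singleton_subset_iff]
    rintro _ ⟨j, rfl⟩
    exact h.apply_X_self hd j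

/-- The action is triangular: x_p goes to 0, the other x_i with i ≠ m to 0 or x_p, and x_m to -∂_j
Q, which is free of x_m. -/
theorem isLocallyNilpotent (h : IsHyperbolic p m F Q) (hd : IsFamily p m F Q d)
    (j : {i : ι // i ≠ p ∧ i ≠ m}) : IsLocallyNilpotent (d j) := by
  classical
  have hp : Ideal.Quotient.mk (Ideal.span {F}) (X p) ∈ nilpotentSubalgebra (d j) :=
    ⟨1, h.apply_X_self hd j⟩
  have hX : ∀ i, i ≠ m → Ideal.Quotient.mk (Ideal.span {F}) (X i) ∈
      nilpotentSubalgebra (d j) := fun i hi => by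
    apply mem_nilpotentSubalgebra_of_apply
    rw [apply_of_mem hd j (X_mem_supported.2 hi)]
    refine mul_mem hp ?_
    rw [pderiv_X, Pi.single_apply]
    split_ifs
    · rw [map_one]; exact one_mem _
    · rw [map_zero]; exact zero_mem _
  have hsupp : supported k {i | i ≠ m} ≤
      (nilpotentSubalgebra (d j)).comap (Ideal.Quotient.mkₐ k (Ideal.span {F})) := by
    rw [supported_eq_adjoin_X, Algebra.adjoin_le_iff]
    rintro _ ⟨i, hi, rfl⟩
    exact hX i hi
  have hm : Ideal.Quotient.mk (Ideal.span {F}) (X m) ∈ nilpotentSubalgebra (d j) := by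
    apply mem_nilpotentSubalgebra_of_apply
    rw [hd, pderiv_X_of_ne j.2.2.symm, pderiv_X_self, mul_zero, mul_one, zero_sub, map_neg]
    exact neg_mem (hsupp (supported_mono (fun i hi => hi.2) (pderiv_mem_supported j.1 h.mem)))
  intro a
  obtain ⟨a, rfl⟩ := Ideal.Quotient.mk_surjective a
  change Ideal.Quotient.mk (Ideal.span {F}) a ∈ nilpotentSubalgebra (d j)
  induction a using MvPolynomial.induction_on with
  | C r => exact Subalgebra.algebraMap_mem _ r
  | add a b ha hb => rw [map_add]; exact add_mem ha hb
  | mul_X a i ha =>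
    rw [map_mul]
    refine mul_mem ha ?_
    by_cases hi : i = m
    · rwa [hi]
    · exact hX i hi

/-- The lifts already commute on the polynomial ring: ∂_m ∂_i Q = 0, and the remaining terms are
symmetric in i and j. -/
theorem commute (h : IsHyperbolic p m F Q) (hd : IsFamily p m F Q d)
    (i j : {i : ι // i ≠ p ∧ i ≠ m}) (a : MvPolynomial ι k ⧸ Ideal.span {F}) :
    d i (d j a) = d j (d i a) := by
  obtain ⟨a, rfl⟩ := Ideal.Quotient.mk_surjective a
  have hm : ∀ i, pderiv m (pderiv i Q) = 0 := fun i =>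
    pderiv_eq_zero_of_mem_supported (fun h => h.2 rfl) (pderiv_mem_supported i h.mem)
  simp only [hd _ _]
  congr 1
  simp only [map_sub, pderiv_mul, hm, pderiv_X_of_ne i.2.1.symm, pderiv_X_of_ne j.2.1.symm,
    pderiv_X_of_ne h.ne, pderiv_comm j.1 i.1, pderiv_comm m]
  ring

/-- Evaluated on the x_i with i ≠ p, m, the derivations form the diagonal matrix with entries x_p ≠
0. -/
theorem linearIndependent (h : IsHyperbolic p m F Q) (hd : IsFamily p m F Q d) :
    LinearIndependent (MvPolynomial ι k ⧸ Ideal.span {F}) d := by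
  classical
  have := h.isDomain
  refine linearIndependent_iff'ₛ.2 fun s c c' hc i hi => ?_
  have h1 := congrArg (fun δ => δ (Ideal.Quotient.mk (Ideal.span {F}) (X i.1))) hc
  have h2 : ∀ j, d j (Ideal.Quotient.mk (Ideal.span {F}) (X i.1)) =
      if j = i then Ideal.Quotient.mk (Ideal.span {F}) (X p) else 0 := fun j => by
    rw [apply_of_mem hd j (X_mem_supported.2 i.2.2), pderiv_X, Pi.single_apply]
    by_cases hij : j = i
    · simp [hij]
    · rw [if_neg fun hh => hij (Subtype.ext hh).symm, if_neg hij, map_zero, mul_zero]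
  have h3 : ∀ (c : _ → MvPolynomial ι k ⧸ Ideal.span {F})
      (t : Finset {i : ι // i ≠ p ∧ i ≠ m}),
      (∑ j ∈ t, c j • d j) (Ideal.Quotient.mk (Ideal.span {F}) (X i.1)) =
        ∑ j ∈ t, c j * d j (Ideal.Quotient.mk (Ideal.span {F}) (X i.1)) := fun c t => by
    induction t using Finset.induction_on with
    | empty => simp
    | insert j t hj ih => rw [Finset.sum_insert hj, Finset.sum_insert hj, ← ih]; simp
  simp only [h3, h2, mul_ite, mul_zero, Finset.sum_ite_eq', hi, if_true] at h1
  exact mul_right_cancel₀ (fun h0 =>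
    X_ne_zero p (h.eq_zero_of_mk_eq_zero (X_mem_supported.2 h.ne) h0)) h1

theorem injective (h : IsHyperbolic p m F Q) (hd : IsFamily p m F Q d) :
    Function.Injective d :=
  have := h.isDomain
  (h.linearIndependent hd).injective

theorem isAdmissible {ι : Type} [Fintype ι] {p m : ι} {F Q : MvPolynomial ι k}
    {d : {i : ι // i ≠ p ∧ i ≠ m} → Derivation k (MvPolynomial ι k ⧸ Ideal.span {F})
      (MvPolynomial ι k ⧸ Ideal.span {F})} (h : IsHyperbolic p m F Q) (hQ : Prime Q)
    (hd : IsFamily p m F Q d) {n : ℕ} (hn : Fintype.card ι = n + 1) :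
    IsAdmissible k (MvPolynomial ι k ⧸ Ideal.span {F}) n (Set.range d) where
  pos := by
    have := Fintype.one_lt_card_iff.2 ⟨p, m, h.ne⟩
    omega
  isDomain := h.isDomain
  ufd := h.uniqueFactorizationMonoid hQ
  trdeg := by rw [h.trdeg, hn, Nat.add_sub_cancel]
  card := by
    classical
    rw [← Set.image_univ, (h.injective hd).encard_image, Set.encard_univ,
      ENat.card_eq_coe_fintype_card, Fintype.card_subtype]
    have : (Finset.univ.filter fun i : ι => i ≠ p ∧ i ≠ m) = (Finset.univ.erase p).erase m := by
      ext i; simp [and_comm]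
    rw [this, Finset.card_erase_of_mem (by simp [h.ne.symm]), Finset.card_erase_of_mem (by simp),
      Finset.card_univ, hn, Nat.add_sub_cancel]
  locallyNilpotent := by
    rintro _ ⟨j, rfl⟩
    exact h.isLocallyNilpotent hd j
  commute := by
    rintro _ ⟨i, rfl⟩ _ ⟨j, rfl⟩ a
    exact h.commute hd i j a
  linearIndependent := (h.linearIndependent hd).linearIndepOn_id

theorem not_hasPolynomialForm {ι : Type} [Fintype ι] {p m : ι} {F Q : MvPolynomial ι k}
    (h : IsHyperbolic p m F Q) (n : ℕ) (D : Set (Derivation k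
      (MvPolynomial ι k ⧸ Ideal.span {F}) (MvPolynomial ι k ⧸ Ideal.span {F})))
    (c : MvPolynomial ι k ⧸ Ideal.span {F}) : ¬ HasPolynomialForm n D c := fun hD =>
  (h.isEmpty_algEquiv _).false hD.nonempty_algEquiv.some

end Derivations

end IsHyperbolic

/-! ### The form without x_0 -/

section Even

variable (k : Type*) [Field k] {ℓ : ℕ}

/-- The part of the form `f` indexed by a finite set. -/
noncomputable def evenPartial (s : Finset (Fin ℓ)) : MvPolynomial (EvenIdx ℓ) k :=
  ∑ i ∈ s, X (Sum.inr i) * X (Sum.inl i)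

/-- Stated for an arbitrary index set so that it serves both f and the remainder Q, whose primality
is also needed. The second index b keeps the remainder nonzero. -/
theorem isHyperbolic_evenPartial {s : Finset (Fin ℓ)} {a b : Fin ℓ} (ha : a ∈ s) (hb : b ∈ s)
    (hab : b ≠ a) : IsHyperbolic (Sum.inl a) (Sum.inr a) (evenPartial k s)
      (evenPartial k (s.erase a)) where
  ne := Sum.inl_ne_inr
  eq := by
    rw [evenPartial, evenPartial, ← Finset.add_sum_erase s _ ha, mul_comm]
  mem := by
    refine sum_mem fun i hi => mul_mem (X_mem_supported.2 ?_) (X_mem_supported.2 ?_) <;>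
    simp [(Finset.mem_erase.1 hi).1]
  ne_zero h0 := by
    have h1 := congrArg (aeval fun i : EvenIdx ℓ =>
      if i = Sum.inl b ∨ i = Sum.inr b then (1 : k) else 0) h0
    simp [evenPartial, hab, hb] at h1
  homogeneous := IsHomogeneous.sum _ _ _ fun i _ =>
    (isHomogeneous_X k _).mul (isHomogeneous_X k _)

theorem isFamily_evenDer (k : Type u) [Field k] [NeZero ℓ] :
    IsHyperbolic.IsFamily (Sum.inl 0) (Sum.inr 0) (evenForm k ℓ)
      (evenPartial k (Finset.univ.erase 0)) (evenDer k ℓ) := by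
  intro j a
  rw [evenDer, quotientDerivation_mk]
  congr 1
  have : evenPolyDer k ℓ j = (X (Sum.inl 0) : MvPolynomial (EvenIdx ℓ) k) • pderiv j.1 -
      pderiv j.1 (evenPartial k (Finset.univ.erase 0)) • pderiv (Sum.inr 0) := by
    refine MvPolynomial.derivation_ext fun i => ?_
    have hQ : pderiv j.1 (evenPartial k (Finset.univ.erase 0)) = X (EvenIdx.opp j.1) := by
      obtain ⟨j | j, h1, h2⟩ := j
      · have hj : j ≠ 0 := fun h => h1 (by rw [h])
        simp [evenPartial, EvenIdx.opp, pderiv_X, Pi.single_apply, hj]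
      · have hj : j ≠ 0 := fun h => h2 (by rw [h])
        simp [evenPartial, EvenIdx.opp, pderiv_X, Pi.single_apply, hj]
    rw [Derivation.sub_apply, Derivation.smul_apply, Derivation.smul_apply, hQ, evenPolyDer,
      mkDerivation_X, pderiv_X, pderiv_X, Pi.single_apply, Pi.single_apply]
    by_cases h1 : i = Sum.inr 0
    · subst h1
      simp [j.2.2.symm]
    · by_cases h2 : i = j.1 <;> simp [h1, h2, j.2.2]
  rw [this]
  rfl

end Even

/-! ### The form with x_0 -/

section Odd

variable (k : Type*) [Field k] {ℓ : ℕ}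

/-- The part of the form `h` indexed by `0` and a finite set. -/
noncomputable def oddPartial (s : Finset (Fin ℓ)) : MvPolynomial (OddIdx ℓ) k :=
  X none ^ 2 + ∑ i ∈ s, X (some (Sum.inr i)) * X (some (Sum.inl i))

/-- The square x_0² keeps the remainder nonzero, so no second index is required. -/
theorem isHyperbolic_oddPartial {s : Finset (Fin ℓ)} {a : Fin ℓ} (ha : a ∈ s) :
    IsHyperbolic (some (Sum.inl a)) (some (Sum.inr a)) (oddPartial k s)
      (oddPartial k (s.erase a)) where
  ne := by simp
  eq := by
    rw [oddPartial, oddPartial, ← Finset.add_sum_erase s _ ha]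
    ring
  mem := by
    refine add_mem (pow_mem (X_mem_supported.2 (by simp)) 2) (sum_mem fun i hi =>
      mul_mem (X_mem_supported.2 ?_) (X_mem_supported.2 ?_)) <;>
    simp [(Finset.mem_erase.1 hi).1]
  ne_zero h0 := by
    have h1 := congrArg (aeval fun i : OddIdx ℓ => if i = none then (1 : k) else 0) h0
    simp [oddPartial] at h1
  homogeneous := (isHomogeneous_X_pow none 2).add (IsHomogeneous.sum _ _ _ fun i _ =>
    (isHomogeneous_X k _).mul (isHomogeneous_X k _))

theorem isFamily_oddDer (k : Type u) [Field k] [NeZero ℓ] :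
    IsHyperbolic.IsFamily (some (Sum.inl 0)) (some (Sum.inr 0)) (oddForm k ℓ)
      (oddPartial k (Finset.univ.erase 0)) (oddDer k ℓ) := by
  intro j a
  rw [oddDer, quotientDerivation_mk]
  congr 1
  have : oddPolyDer k ℓ j = (X (some (Sum.inl 0)) : MvPolynomial (OddIdx ℓ) k) • pderiv j.1 -
      pderiv j.1 (oddPartial k (Finset.univ.erase 0)) • pderiv (some (Sum.inr 0)) := by
    refine MvPolynomial.derivation_ext fun i => ?_
    have hQ : pderiv j.1 (oddPartial k (Finset.univ.erase 0)) =
        if j.1 = none then 2 * X none else X (OddIdx.opp j.1) := by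
      obtain ⟨_ | j | j, h1, h2⟩ := j
      · simp [oddPartial, pderiv_X]
      · have hj : j ≠ 0 := fun h => h1 (by rw [h])
        simp [oddPartial, OddIdx.opp, pderiv_X, Pi.single_apply, hj]
      · have hj : j ≠ 0 := fun h => h2 (by rw [h])
        simp [oddPartial, OddIdx.opp, pderiv_X, Pi.single_apply, hj]
    rw [Derivation.sub_apply, Derivation.smul_apply, Derivation.smul_apply, hQ, oddPolyDer,
      mkDerivation_X, pderiv_X, pderiv_X, Pi.single_apply, Pi.single_apply]
    by_cases h1 : i = some (Sum.inr 0)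
    · subst h1
      by_cases h3 : j.1 = none <;> simp [j.2.2.symm, h3]
    · by_cases h2 : i = j.1 <;> simp [h1, h2, j.2.2]
  rw [this]
  rfl

end Odd

/-! ### Assembly of the two examples and the negative answer -/

theorem evenCone_properties (k : Type u) [Field k] [CharZero k] (ℓ : ℕ) [NeZero ℓ]
    (hℓ : 3 ≤ ℓ) :
    (∀ σ : Type v, IsEmpty (EvenCone k ℓ ≃ₐ[k] MvPolynomial σ k)) ∧
    (∀ a : EvenCone k ℓ, IsUnit a ↔ ∃ r : k, r ≠ 0 ∧ algebraMap k (EvenCone k ℓ) r = a) ∧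
    Function.Injective (evenDer k ℓ) ∧
    IsAdmissible k (EvenCone k ℓ) (2 * ℓ - 1) (Set.range (evenDer k ℓ)) ∧
    (∃ c : EvenCone k ℓ, invariants (Set.range (evenDer k ℓ)) = Algebra.adjoin k {c}) ∧
    (∀ c : EvenCone k ℓ, invariants (Set.range (evenDer k ℓ)) = Algebra.adjoin k {c} →
      ¬ HasPolynomialForm (2 * ℓ - 1) (Set.range (evenDer k ℓ)) c) := by
  -- Three pairs are needed: 0 splits off from f, b splits off from Q, and c keeps what is left
  -- nonzero. For ℓ = 2 the form Q = x_{-2} x_2 is not prime.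
  let b : Fin ℓ := ⟨1, by omega⟩
  let c : Fin ℓ := ⟨2, by omega⟩
  have hb : b ≠ 0 := fun h => by simpa [b] using congrArg Fin.val h
  have hc : c ≠ 0 := fun h => by simpa [c] using congrArg Fin.val h
  have hcb : c ≠ b := fun h => by simpa [b, c] using congrArg Fin.val h
  have h : IsHyperbolic (Sum.inl 0) (Sum.inr 0) (evenForm k ℓ)
      (evenPartial k (Finset.univ.erase 0)) :=
    isHyperbolic_evenPartial k (Finset.mem_univ 0) (Finset.mem_univ b) hb
  have hQ : Prime (evenPartial k (Finset.univ.erase (0 : Fin ℓ))) :=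
    (isHyperbolic_evenPartial k (a := b) (b := c) (by simpa using hb) (by simpa using hc)
      hcb).prime
  have hd := isFamily_evenDer (ℓ := ℓ) k
  exact ⟨h.isEmpty_algEquiv, h.isUnit_iff, h.injective hd,
    h.isAdmissible hQ hd (by simp; omega), ⟨_, h.invariants_eq hQ hd⟩,
    fun c _ => h.not_hasPolynomialForm _ _ c⟩

theorem oddCone_properties (k : Type u) [Field k] [CharZero k] (ℓ : ℕ) [NeZero ℓ]
    (hℓ : 2 ≤ ℓ) :
    (∀ σ : Type v, IsEmpty (OddCone k ℓ ≃ₐ[k] MvPolynomial σ k)) ∧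
    (∀ a : OddCone k ℓ, IsUnit a ↔ ∃ r : k, r ≠ 0 ∧ algebraMap k (OddCone k ℓ) r = a) ∧
    Function.Injective (oddDer k ℓ) ∧
    IsAdmissible k (OddCone k ℓ) (2 * ℓ) (Set.range (oddDer k ℓ)) ∧
    (∃ c : OddCone k ℓ, invariants (Set.range (oddDer k ℓ)) = Algebra.adjoin k {c}) ∧
    (∀ c : OddCone k ℓ, invariants (Set.range (oddDer k ℓ)) = Algebra.adjoin k {c} →
      ¬ HasPolynomialForm (2 * ℓ) (Set.range (oddDer k ℓ)) c) := by
  -- The pair b splits off from Q; for ℓ = 1 the form Q = x_0² is not prime.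
  let b : Fin ℓ := ⟨1, by omega⟩
  have hb : b ≠ 0 := fun h => by simpa [b] using congrArg Fin.val h
  have h : IsHyperbolic (some (Sum.inl 0)) (some (Sum.inr 0)) (oddForm k ℓ)
      (oddPartial k (Finset.univ.erase 0)) :=
    isHyperbolic_oddPartial k (Finset.mem_univ 0)
  have hQ : Prime (oddPartial k (Finset.univ.erase (0 : Fin ℓ))) :=
    (isHyperbolic_oddPartial k (a := b) (by simpa using hb)).prime
  have hd := isFamily_oddDer (ℓ := ℓ) k
  exact ⟨h.isEmpty_algEquiv, h.isUnit_iff, h.injective hd,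
    h.isAdmissible hQ hd (by simp; omega), ⟨_, h.invariants_eq hQ hd⟩,
    fun c _ => h.not_hasPolynomialForm _ _ c⟩

theorem not_affirmativeAnswer (k : Type u) [Field k] [CharZero k] (n : ℕ) (hn : 4 ≤ n) :
    ¬ AffirmativeAnswer k n := by
  intro H
  -- Even n uses the cone with x_0, odd n the one without; n ≥ 4 gives ℓ ≥ 2 and ℓ ≥ 3 respectively.
  obtain ⟨ℓ, rfl | rfl⟩ : ∃ ℓ, n = 2 * ℓ ∨ n = 2 * ℓ - 1 := ⟨(n + 1) / 2, by omega⟩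
  · have : NeZero ℓ := ⟨by omega⟩
    obtain ⟨-, -, -, hD, ⟨c, hc⟩, hneg⟩ := oddCone_properties.{u, 0} k ℓ (by omega)
    exact hneg c hc (H _ _ hD c hc)
  · have : NeZero ℓ := ⟨by omega⟩
    obtain ⟨-, -, -, hD, ⟨c, hc⟩, hneg⟩ := evenCone_properties.{u, 0} k ℓ (by omega)
    exact hneg c hc (H _ _ hD c hc)

end KahouiQuestion

theorem mainTheorem5 (k : Type u) [Field k] [IsAlgClosed k] [CharZero k] :
    -- the quadric cone `x_{-1} x_1 + ⋯ + x_{-ℓ} x_ℓ = 0`, `ℓ ≥ 3`, `n = 2ℓ - 1`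
    (∀ (ℓ : ℕ) [NeZero ℓ], 3 ≤ ℓ →
      (∀ σ : Type v, IsEmpty (EvenCone k ℓ ≃ₐ[k] MvPolynomial σ k)) ∧
      (∀ a : EvenCone k ℓ, IsUnit a ↔ ∃ r : k, r ≠ 0 ∧ algebraMap k (EvenCone k ℓ) r = a) ∧
      Function.Injective (evenDer k ℓ) ∧
      IsAdmissible k (EvenCone k ℓ) (2 * ℓ - 1) (Set.range (evenDer k ℓ)) ∧
      (∃ c : EvenCone k ℓ, invariants (Set.range (evenDer k ℓ)) = Algebra.adjoin k {c}) ∧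
      (∀ c : EvenCone k ℓ, invariants (Set.range (evenDer k ℓ)) = Algebra.adjoin k {c} →
        ¬ HasPolynomialForm (2 * ℓ - 1) (Set.range (evenDer k ℓ)) c)) ∧
    -- the quadric cone `x_0² + x_{-1} x_1 + ⋯ + x_{-ℓ} x_ℓ = 0`, `ℓ ≥ 2`, `n = 2ℓ`
    (∀ (ℓ : ℕ) [NeZero ℓ], 2 ≤ ℓ →
      (∀ σ : Type v, IsEmpty (OddCone k ℓ ≃ₐ[k] MvPolynomial σ k)) ∧
      (∀ a : OddCone k ℓ, IsUnit a ↔ ∃ r : k, r ≠ 0 ∧ algebraMap k (OddCone k ℓ) r = a) ∧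
      Function.Injective (oddDer k ℓ) ∧
      IsAdmissible k (OddCone k ℓ) (2 * ℓ) (Set.range (oddDer k ℓ)) ∧
      (∃ c : OddCone k ℓ, invariants (Set.range (oddDer k ℓ)) = Algebra.adjoin k {c}) ∧
      (∀ c : OddCone k ℓ, invariants (Set.range (oddDer k ℓ)) = Algebra.adjoin k {c} →
        ¬ HasPolynomialForm (2 * ℓ) (Set.range (oddDer k ℓ)) c)) ∧
    -- the answer is negative in every dimension at least `4`
    (∀ n : ℕ, 4 ≤ n → ¬ AffirmativeAnswer k n) :=
  ⟨fun ℓ _ hℓ => evenCone_properties k ℓ hℓ, fun ℓ _ hℓ => oddCone_properties k ℓ hℓ,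
    not_affirmativeAnswer k⟩
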